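/- **Conventions.** A 2-crossed module of groups $\mathcal A=(L\xrightarrow{\delta}E\xrightarrow{\partial}G,\triangleright,\{,\})$ consists of group morphisms $\delta,\partial$ with $\partial\circ\delta=1$, left actions $\triangleright$ of $G$ by automorphisms on $E$ and $L$ (and on $G$ by conjugation) for which $\partial$ and $\delta$ are equivariant, and a $G$-equivariant map $\{,\}\colon E\times E\to L$ such that $\delta\{e,f\}=efe^{-1}\,(\partial(e)\triangleright f^{-1})$; $[l,k]=\{\delta(l),\delta(k)\}$; $\{\delta(l),e\}\{e,\delta(l)\}=l\,(\partial(e)\triangleright l^{-1})$; $\{ef,g\}=\{e,fgf^{-1}\}\,\partial(e)\triangleright\{f,g\}$; $\{e,fg\}=\{e,f\}\,(\partial(e)\triangleright f)\triangleright'\{e,g\}$, where $e\triangleright' l=l\{\delta(l)^{-1},e\}$. Actions bind more tightly than products. A (strict) morphism $f=(\mu,\psi,\phi)\colon\mathcal A\to\mathcal A'$ is a triple of group morphisms $L\to L'$, $E\to E'$, $G\to G'$ that commutes with $\delta,\partial$ and preserves the actions and $\{,\}$. *Homotopy.* For a morphism $f=(\mu,\psi,\phi)\colon\mathcal A\to\mathcal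 A'$, a $\phi$-derivation is a map $s\colon G\to E'$ with $s(gh)=\phi(h)^{-1}\triangleright s(g)\;s(h)$. A quadratic $f$-derivation is a pair $(s,t)$ in which $s\colon G\to E'$ is a $\phi$-derivation and $t\colon E\to L'$ is a map with $$t(ab)=\big(\psi(b)\,s(\partial b)\big)^{-1}\triangleright'\Big(\big\{\psi(b),\phi(\partial(b)^{-1})\triangleright s(\partial a)^{-1}\big\}\,t(a)\Big)\,t(b),$$ $$t(g\triangleright a)=\phi(g)\triangleright\Big(\big(s(g)s(\partial a)^{-1}\big)\triangleright'\{\psi(a)^{-1},s(g)^{-1}\}^{-1}\Big)\;\phi(g)\triangleright\{s(g),s(\partial a)^{-1}\psi(a)^{-1}\}\;\big(\phi(g)\,\partial(s(g))\big)\triangleright t(a)$$ for all $a,b\in E$, $g\in G$. It is a homotopy $f\to f'=(\mu',\psi',\phi')$ if $\mu'(l)=\mu(l)\,t(\delta l)$, $\psi'(a)=\psi(a)\,s(\partial a)\,\delta(t(a))$ and $\phi'(g)=\phi(g)\,\partial(s(g))$. *Resolution.* Let $F(G)$ be the free group on the underlying set of $G$, with generators $[g]$, and let $p\colon F(G)\to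 G$ be the morphism with $p([g])=g$. Then $Q^1(\mathcal A)=\big(L\xrightarrow{\delta'}E\,{}_{\partial}\!\times_p F(G)\xrightarrow{\partial'}F(G)\big)$, where $E\,{}_\partial\!\times_p F(G)=\{(e,u):\partial(e)=p(u)\}$, $\delta'(k)=(\delta(k),1)$, $\partial'(e,u)=u$, $u\triangleright(e,u')=(p(u)\triangleright e,\,uu'u^{-1})$, $u\triangleright k=p(u)\triangleright k$ and $\{(e,u),(e',u')\}=\{e,e'\}$. The morphism $\mathrm{proj}\colon Q^1(\mathcal A)\to\mathcal A$ is $(\mathrm{id},(e,u)\mapsto e,p)$. A lax homotopy connecting morphisms $f_1,f_2\colon\mathcal A\to\mathcal A'$ is a homotopy $(s,t)$ from $f_1\circ\mathrm{proj}$ to $f_2\circ\mathrm{proj}$. **Theorem.** Let $\mathcal A=(L\to E\to G)$ and $\mathcal A'=(L'\to E'\to G')$ be 2-crossed modules, and let $f_1=(\mu_1,\psi_1,\phi_1)\colon\mathcal A\to\mathcal A'$ be a morphism. Consider triples of set maps $\hat s\colon G\to E'$, $\hat t\colon E\to L'$, $\Pi\colon G\times G\to L'$ such that, for all $g,h,i\in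 G$ and $a,b\in E$, 1. $\partial(\hat s(gh))=\partial\big(\phi_1(h)^{-1}\triangleright\hat s(g)\;\hat s(h)\big)$; 2. $\hat s(gh)=\phi_1(h)^{-1}\triangleright\hat s(g)\;\hat s(h)\;\delta(\Pi(g,h))$; 3. $\Pi(\partial a,\partial b)\,\hat t(ab)=\hat s(\partial b)^{-1}\triangleright'\Big(\{\psi_1(b)^{-1},\hat s(\partial a)^{-1}\}^{-1}\;\psi_1(b)^{-1}\triangleright'\hat t(a)\Big)\;\hat t(b)$; 4. $\phi_1(g)\triangleright\Big(\big(\hat s(g)\hat s(\partial a)^{-1}\big)\triangleright'\{\psi_1(a)^{-1},\hat s(g)^{-1}\}^{-1}\Big)\;\phi_1(g)\triangleright\{\hat s(g),\hat s(\partial a)^{-1}\psi_1(a)^{-1}\}\;\big(\phi_1(g)\,\partial(\hat s(g))\big)\triangleright\hat t(a)$ $=\Pi(1,1)^{-1}\,\Pi(g,g^{-1})^{-1}\,\Pi(\partial a,g^{-1})\,\Pi(g,\partial(a)g^{-1})\,\hat t(g\triangleright a)$; 5. $\hat s(i)^{-1}\triangleright'\big(\phi_1(i)^{-1}\triangleright\Pi(g,h)\big)\;\Pi(gh,i)=\Pi(h,i)\,\Pi(g,hi)$.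 (a) For every morphism $f_2=(\mu_2,\psi_2,\phi_2)\colon\mathcal A\to\mathcal A'$, the assignment $\hat s(g)=s([g])$, $\hat t(e)=t(e,[\partial e])$, $\Pi(g,h)=t(1,[gh]^{-1}[g][h])$ is a bijection from the set of lax homotopies $(s,t)$ connecting $f_1$ and $f_2$ onto the set of triples $(\hat s,\hat t,\Pi)$ that satisfy (1)–(5) and, for all $g\in G$, $e\in E$, $l\in L$, $$\phi_2(g)=\phi_1(g)\,\partial(\hat s(g)),\qquad\psi_2(e)=\psi_1(e)\,\hat s(\partial e)\,\delta(\hat t(e)),\qquad\mu_2(l)=\mu_1(l)\,\Pi(1,1)^{-1}\,\hat t(\delta l).\qquad(\ast)$$ (b) For every triple satisfying (1)–(5) there is exactly one morphism $f_2\colon\mathcal A\to\mathcal A'$ given by $(\ast)$. (c) Every set map $\hat s\colon G\to E'$ extends uniquely to a $(\phi_1\circ p)$-derivation $s\colon F(G)\to E'$ with $s([g])=\hat s(g)$, and the elements $(e,[\partial e])$ with $e\in E$ and $(1,[gh]^{-1}[g][h])$ with $g,h\in G$ generate the group $E\,{}_\partial\!\times_p F(G)$. -/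

import Mathlib

/-- A 2-crossed module of groups `L --δ--> E --∂--> G`, with left actions of `G` by automorphisms on
`E` and `L` (and on `G` by conjugation) and Peiffer lifting `{e, f} = lift e f`. -/
structure TwoCrossedModule (L E G : Type*) [Group L] [Group E] [Group G] where
  δ : L →* E
  bd : E →* G
  actE : G →* MulAut E
  actL : G →* MulAut L
  lift : E → E → L
  bd_δ : ∀ l, bd (δ l) = 1
  bd_act : ∀ g e, bd (actE g e) = g * bd e * g⁻¹
  δ_act : ∀ g l, δ (actL g l) = actE g (δ l)
  act_lift : ∀ g e f, actL g (lift e f) = lift (actE g e) (actE g f)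
  δ_lift : ∀ e f, δ (lift e f) = (e * f * e⁻¹) * actE (bd e) f⁻¹
  lift_δ_δ : ∀ l k, l * k * l⁻¹ * k⁻¹ = lift (δ l) (δ k)
  lift_δ_mul : ∀ l e, lift (δ l) e * lift e (δ l) = l * actL (bd e) l⁻¹
  lift_mul_left : ∀ e f g, lift (e * f) g = lift e (f * g * f⁻¹) * actL (bd e) (lift f g)
  /-- `{e, fg} = {e, f} ((∂e ▷ f) ▷' {e, g})`, where `x ▷' l = l {(δ l)⁻¹, x}`. -/
  lift_mul_right : ∀ e f g, lift e (f * g) =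
    lift e f * (lift e g * lift (δ (lift e g))⁻¹ (actE (bd e) f))

namespace TwoCrossedModule

section Basic

variable {L E G : Type*} [Group L] [Group E] [Group G]
variable {L' E' G' : Type*} [Group L'] [Group E'] [Group G']
variable {L'' E'' G'' : Type*} [Group L''] [Group E''] [Group G'']

/-- The secondary action `e ▷' l = l {(δ l)⁻¹, e}` of `E` on `L`. -/
def sec (A : TwoCrossedModule L E G) (e : E) (l : L) : L := l * A.lift (A.δ l)⁻¹ e

/-- A (strict) morphism of 2-crossed modules `(μ, ψ, φ)`. -/
structure Hom (A : TwoCrossedModule L E G) (A' : TwoCrossedModule L' E' G') where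
  μ : L →* L'
  ψ : E →* E'
  φ : G →* G'
  δ_comm : ∀ l, A'.δ (μ l) = ψ (A.δ l)
  bd_comm : ∀ e, A'.bd (ψ e) = φ (A.bd e)
  map_lift : ∀ e f, μ (A.lift e f) = A'.lift (ψ e) (ψ f)
  map_actL : ∀ g l, μ (A.actL g l) = A'.actL (φ g) (μ l)
  map_actE : ∀ g e, ψ (A.actE g e) = A'.actE (φ g) (ψ e)

/-- Composition of morphisms (`f.comp h` is `f ∘ h`). -/
def Hom.comp {A : TwoCrossedModule L E G} {A' : TwoCrossedModule L' E' G'}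
    {A'' : TwoCrossedModule L'' E'' G''} (f : Hom A' A'') (h : Hom A A') : Hom A A'' where
  μ := f.μ.comp h.μ
  ψ := f.ψ.comp h.ψ
  φ := f.φ.comp h.φ
  δ_comm l := by simp [f.δ_comm, h.δ_comm]
  bd_comm e := by simp [f.bd_comm, h.bd_comm]
  map_lift e e' := by simp [f.map_lift, h.map_lift]
  map_actL g l := by simp [f.map_actL, h.map_actL]
  map_actE g e := by simp [f.map_actE, h.map_actE]

/-- A `φ`-derivation `s : G → E'`: `s(gh) = (φ(h)⁻¹ ▷ s(g)) s(h)`. -/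
def IsDerivation (A' : TwoCrossedModule L' E' G') (φ : G →* G') (s : G → E') : Prop :=
  ∀ g h, s (g * h) = A'.actE (φ h)⁻¹ (s g) * s h

/-- A quadratic `f`-derivation `(s, t)`, `s : G → E'`, `t : E → L'`. -/
structure IsQuadraticDerivation {A : TwoCrossedModule L E G} {A' : TwoCrossedModule L' E' G'}
    (f : Hom A A') (s : G → E') (t : E → L') : Prop where
  deriv : IsDerivation A' f.φ s
  mul : ∀ a b, t (a * b) =
    A'.sec (f.ψ b * s (A.bd b))⁻¹
      (A'.lift (f.ψ b) (A'.actE (f.φ (A.bd b)⁻¹) (s (A.bd a))⁻¹) * t a) * t b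
  act : ∀ g a, t (A.actE g a) =
    A'.actL (f.φ g) (A'.sec (s g * (s (A.bd a))⁻¹) (A'.lift (f.ψ a)⁻¹ (s g)⁻¹)⁻¹) *
      A'.actL (f.φ g) (A'.lift (s g) ((s (A.bd a))⁻¹ * (f.ψ a)⁻¹)) *
      A'.actL (f.φ g * A'.bd (s g)) (t a)

/-- `(f, s, t)` is a homotopy connecting the morphisms `f` and `f'`. -/
structure IsHomotopy {A : TwoCrossedModule L E G} {A' : TwoCrossedModule L' E' G'}
    (f f' : Hom A A') (s : G → E') (t : E → L') : Prop where
  quadratic : IsQuadraticDerivation f s t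
  μ_eq : ∀ l, f'.μ l = f.μ l * t (A.δ l)
  ψ_eq : ∀ a, f'.ψ a = f.ψ a * s (A.bd a) * A'.δ (t a)
  φ_eq : ∀ g, f'.φ g = f.φ g * A'.bd (s g)

end Basic

section Resolution

variable {L E G : Type*} [Group L] [Group E] [Group G]

/-- The projection `p : F(G) → G`, `[g] ↦ g`, from the free group on the underlying set of `G`. -/
def freeProj (G : Type*) [Group G] : FreeGroup G →* G := FreeGroup.lift id

/-- The pullback `E ×_{∂,p} F(G) = {(e, u) | ∂ e = p u}`. -/
def pullback (A : TwoCrossedModule L E G) : Subgroup (E × FreeGroup G) where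
  carrier := {x | A.bd x.1 = freeProj G x.2}
  one_mem' := by simp
  mul_mem' := by
    intro x y hx hy
    simp only [Set.mem_ofPred_eq] at hx hy
    simp [hx, hy]
  inv_mem' := by
    intro x hx
    simp only [Set.mem_ofPred_eq] at hx
    simp [hx]

theorem mem_pullback (A : TwoCrossedModule L E G) (x : E × FreeGroup G) :
    x ∈ A.pullback ↔ A.bd x.1 = freeProj G x.2 := Iff.rfl

/-- The element `u ▷ (e, u') = (p(u) ▷ e, u u' u⁻¹)` of `E ×_{∂,p} F(G)`. -/
def pullbackActFun (A : TwoCrossedModule L E G) (u : FreeGroup G) (x : A.pullback) : A.pullback :=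
  ⟨(A.actE (freeProj G u) x.1.1, u * x.1.2 * u⁻¹), by
    have hx := (A.mem_pullback _).1 x.2
    simp [mem_pullback, A.bd_act, hx]⟩

theorem pullbackActFun_mul (A : TwoCrossedModule L E G) (u v : FreeGroup G) (x : A.pullback) :
    A.pullbackActFun (u * v) x = A.pullbackActFun u (A.pullbackActFun v x) := by
  apply Subtype.ext
  simp [pullbackActFun, mul_assoc]

theorem pullbackActFun_one (A : TwoCrossedModule L E G) (x : A.pullback) :
    A.pullbackActFun 1 x = x := by
  apply Subtype.ext
  simp [pullbackActFun]

/-- The action of `F(G)` on `E ×_{∂,p} F(G)` by automorphisms. -/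
def pullbackAct (A : TwoCrossedModule L E G) : FreeGroup G →* MulAut A.pullback where
  toFun u :=
    { toFun := A.pullbackActFun u
      invFun := A.pullbackActFun u⁻¹
      left_inv := fun x => by rw [← pullbackActFun_mul, inv_mul_cancel, pullbackActFun_one]
      right_inv := fun x => by rw [← pullbackActFun_mul, mul_inv_cancel, pullbackActFun_one]
      map_mul' := fun x y => by
        apply Subtype.ext
        simp [pullbackActFun, mul_assoc] }
  map_one' := by
    ext1 x
    exact A.pullbackActFun_one x
  map_mul' u v := by
    ext1 x
    exact A.pullbackActFun_mul u v x

@[simp] theorem pullbackAct_coe (A : TwoCrossedModule L E G) (u : FreeGroup G) (x : A.pullback) :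
    ((A.pullbackAct u x : A.pullback) : E × FreeGroup G) =
      (A.actE (freeProj G u) x.1.1, u * x.1.2 * u⁻¹) := rfl

/-- `δ' : L → E ×_{∂,p} F(G)`, `δ'(k) = (δ k, ∅)`. -/
def pullbackδ (A : TwoCrossedModule L E G) : L →* A.pullback where
  toFun k := ⟨(A.δ k, 1), by simp [mem_pullback, A.bd_δ]⟩
  map_one' := by
    apply Subtype.ext
    simp
  map_mul' k l := by
    apply Subtype.ext
    simp

@[simp] theorem pullbackδ_coe (A : TwoCrossedModule L E G) (k : L) :
    ((A.pullbackδ k : A.pullback) : E × FreeGroup G) = (A.δ k, 1) := rfl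

/-- `∂' : E ×_{∂,p} F(G) → F(G)`, `∂'(e, u) = u`. -/
def pullbackBd (A : TwoCrossedModule L E G) : A.pullback →* FreeGroup G :=
  (MonoidHom.snd E (FreeGroup G)).comp A.pullback.subtype

@[simp] theorem pullbackBd_apply (A : TwoCrossedModule L E G) (x : A.pullback) :
    A.pullbackBd x = x.1.2 := rfl

/-- The resolution `Q¹(A) = (L → E ×_{∂,p} F(G) → F(G))`, with `u ▷ k = p(u) ▷ k` and
`{(e, u), (e', u')} = {e, e'}`. -/
def resolution (A : TwoCrossedModule L E G) : TwoCrossedModule L A.pullback (FreeGroup G) where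
  δ := A.pullbackδ
  bd := A.pullbackBd
  actE := A.pullbackAct
  actL := A.actL.comp (freeProj G)
  lift x y := A.lift x.1.1 y.1.1
  bd_δ l := by simp
  bd_act g e := by simp
  δ_act g l := by
    apply Subtype.ext
    simp [A.δ_act]
  act_lift g e f := by simp [A.act_lift]
  δ_lift e f := by
    have he := (A.mem_pullback _).1 e.2
    apply Subtype.ext
    apply Prod.ext <;> simp [A.δ_lift, he, mul_assoc]
  lift_δ_δ l k := by simp [A.lift_δ_δ]
  lift_δ_mul l e := by
    have he := (A.mem_pullback _).1 e.2
    simpa [he] using A.lift_δ_mul l e.1.1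
  lift_mul_left e f g := by
    have he := (A.mem_pullback _).1 e.2
    simpa [he] using A.lift_mul_left e.1.1 f.1.1 g.1.1
  lift_mul_right e f g := by
    have he := (A.mem_pullback _).1 e.2
    simpa [he] using A.lift_mul_right e.1.1 f.1.1 g.1.1

/-- The projection `proj = (id, q, p) : Q¹(A) → A`, with `q(e, u) = e`. -/
def proj (A : TwoCrossedModule L E G) : Hom A.resolution A where
  μ := MonoidHom.id L
  ψ := (MonoidHom.fst E (FreeGroup G)).comp A.pullback.subtype
  φ := freeProj G
  δ_comm _ := rfl
  bd_comm e := (A.mem_pullback _).1 e.2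
  map_lift _ _ := rfl
  map_actL _ _ := rfl
  map_actE _ _ := rfl

/-- The element `[e] = (e, [∂ e])` of `E ×_{∂,p} F(G)`. -/
def genE (A : TwoCrossedModule L E G) (e : E) : A.pullback :=
  ⟨(e, FreeGroup.of (A.bd e)), by simp [mem_pullback, freeProj]⟩

/-- The element `(g, h) = (1, [gh]⁻¹ [g] [h])` of `E ×_{∂,p} F(G)`. -/
def genG (A : TwoCrossedModule L E G) (g h : G) : A.pullback :=
  ⟨(1, (FreeGroup.of (g * h))⁻¹ * FreeGroup.of g * FreeGroup.of h), by
    simp [mem_pullback, freeProj, mul_assoc]⟩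

end Resolution

section Lax

variable {L E G : Type*} [Group L] [Group E] [Group G]
variable {L' E' G' : Type*} [Group L'] [Group E'] [Group G']

/-- A lax homotopy `(s, t)` connecting the strict maps `f₁, f₂ : A → A'` is a homotopy connecting
`f₁ ∘ proj` and `f₂ ∘ proj : Q¹(A) → A'`. -/
def IsLaxHomotopy {A : TwoCrossedModule L E G} {A' : TwoCrossedModule L' E' G'}
    (f₁ f₂ : Hom A A') (s : FreeGroup G → E') (t : A.pullback → L') : Prop :=
  IsHomotopy (f₁.comp A.proj) (f₂.comp A.proj) s t

/-- The equations on a triple `(ŝ, t̂, Π)`, `ŝ : G → E'`, `t̂ : E → L'`, `Π : G × G → L'`. -/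
structure IsLaxTriple {A : TwoCrossedModule L E G} {A' : TwoCrossedModule L' E' G'}
    (f : Hom A A') (s : G → E') (t : E → L') (P : G × G → L') : Prop where
  lax1 : ∀ g h, A'.bd (s (g * h)) = A'.bd (A'.actE (f.φ h)⁻¹ (s g) * s h)
  lax2 : ∀ g h, s (g * h) = A'.actE (f.φ h)⁻¹ (s g) * s h * A'.δ (P (g, h))
  lax3 : ∀ a b, P (A.bd a, A.bd b) * t (a * b) =
    A'.sec (s (A.bd b))⁻¹
      ((A'.lift (f.ψ b)⁻¹ (s (A.bd a))⁻¹)⁻¹ * A'.sec (f.ψ b)⁻¹ (t a)) * t b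
  lax4 : ∀ g a,
    A'.actL (f.φ g) (A'.sec (s g * (s (A.bd a))⁻¹) (A'.lift (f.ψ a)⁻¹ (s g)⁻¹)⁻¹) *
      A'.actL (f.φ g) (A'.lift (s g) ((s (A.bd a))⁻¹ * (f.ψ a)⁻¹)) *
      A'.actL (f.φ g * A'.bd (s g)) (t a) =
    (P (1, 1))⁻¹ * (P (g, g⁻¹))⁻¹ * P (A.bd a, g⁻¹) * P (g, A.bd a * g⁻¹) * t (A.actE g a)
  lax5 : ∀ g h i, A'.sec (s i)⁻¹ (A'.actL (f.φ i)⁻¹ (P (g, h))) * P (g * h, i) =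
    P (h, i) * P (g, h * i)

/-- The formulas expressing `f₂` through `f₁` and the triple `(ŝ, t̂, Π)`. -/
structure IsLaxTarget {A : TwoCrossedModule L E G} {A' : TwoCrossedModule L' E' G'}
    (f₁ f₂ : Hom A A') (s : G → E') (t : E → L') (P : G × G → L') : Prop where
  φ_eq : ∀ g, f₂.φ g = f₁.φ g * A'.bd (s g)
  ψ_eq : ∀ e, f₂.ψ e = f₁.ψ e * s (A.bd e) * A'.δ (t e)
  μ_eq : ∀ l, f₂.μ l = f₁.μ l * (P (1, 1))⁻¹ * t (A.δ l)

/-- The values of `(s, t)` on generators: `ŝ(g) = s([g])`, `t̂(e) = t(e, [∂ e])` and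
`Π(g, h) = t(1, [gh]⁻¹ [g] [h])`. -/
def restrict (A : TwoCrossedModule L E G) {L' E' : Type*}
    (st : (FreeGroup G → E') × (A.pullback → L')) : (G → E') × (E → L') × (G × G → L') :=
  (fun g => st.1 (FreeGroup.of g), fun e => st.2 (A.genE e), fun x => st.2 (A.genG x.1 x.2))

end Lax

end TwoCrossedModule

/-! A lax homotopy is a quadratic derivation on `Q¹(A)`. There `s` is fixed by its values on free
generators, since derivations are lifts to a semidirect product, and `t` by its values on a
generating set (`closure_generators`, `eq_of_closure`).

The target `f₂ ∘ proj` forces `s(u) = δ(t(1,u))⁻¹` on the kernel of `proj`, so `t(xk) = t(k) t(x)`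
for `k` in it. Applying `t` to three relations between generators then yields (3), (4) and (5)
(`isLaxTriple`).

Conversely, by (2) and (5), `Π` and the automorphisms `ŝ(g)⁻¹ ▷' (φ₁(g)⁻¹ ▷ ·)` form a nonabelian
factor system. Its extension of `G` receives a morphism from `F(G)` with `[g] ↦ (g, 1)`. With `c(u)`
its second component, `s(u) = ŝ(p u) δ(c(u))⁻¹` and `t(e,u) = c(u) t̂(e)` solve the extension
problem: (3) gives the product rule and (4) the action rule (`isQuadraticDerivation_free`).

Every quadratic derivation ends in a morphism; the Peiffer lifting is the hard case (`map_δ_lift`).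
For the derivation above this morphism does not see `c`, so it descends to `A`, giving (b). -/

namespace TwoCrossedModule

/-! ### Peiffer lifting calculus and the secondary action -/

section Basic

variable {L E G : Type*} [Group L] [Group E] [Group G] (A : TwoCrossedModule L E G)

attribute [simp] bd_δ bd_act

@[simp] theorem lift_one_left (e : E) : A.lift 1 e = 1 := by
  simpa using A.lift_mul_left 1 1 e

@[simp] theorem lift_one_right (e : E) : A.lift e 1 = 1 := by
  have h := A.lift_mul_right e 1 1
  have h2 : A.δ (A.lift e 1) = 1 := by simp [A.δ_lift]
  simpa [h2] using h

theorem sec_δ (k l : L) : A.sec (A.δ k) l = k * l * k⁻¹ := by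
  rw [sec, ← map_inv, ← lift_δ_δ]
  group

/-- Left expansion of `{δ(k)⁻¹ δ(l)⁻¹, e}` conjugates `e` by `δ(l)⁻¹`; since `∂δ = 1`, that
conjugate is `δ{δ(l)⁻¹, e} e`, to which right expansion applies. -/
theorem sec_mul_right (e : E) (l k : L) : A.sec e (l * k) = A.sec e l * A.sec e k := by
  have h1 : A.δ (A.lift (A.δ l)⁻¹ e) * e = (A.δ l)⁻¹ * e * A.δ l := by
    simp [A.δ_lift]
  have h2 : A.lift (A.δ k)⁻¹ ((A.δ l)⁻¹ * e * A.δ l) =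
      k⁻¹ * A.lift (A.δ l)⁻¹ e * k * A.lift (A.δ k)⁻¹ e * (A.lift (A.δ l)⁻¹ e)⁻¹ := by
    rw [← h1, lift_mul_right, ← map_inv, ← lift_δ_δ]
    have := A.sec_δ (A.lift (A.δ l)⁻¹ e) (A.lift (A.δ k⁻¹) e)
    rw [sec] at this
    simp only [map_inv, bd_δ, inv_one, map_one, MulAut.one_apply] at this ⊢
    rw [this]
    group
  have h3 := A.lift_mul_left (A.δ k)⁻¹ (A.δ l)⁻¹ e
  rw [inv_inv, h2] at h3
  simp only [sec, map_mul, mul_inv_rev, h3]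
  simp [mul_assoc]

theorem sec_one_left (l : L) : A.sec 1 l = l := by simp [sec]

theorem sec_mul_left (e f : E) (l : L) : A.sec (e * f) l = A.sec e (A.sec f l) := by
  have h := A.lift_mul_right (A.δ l)⁻¹ e f
  have hf : A.sec f l = l * A.lift (A.δ l)⁻¹ f := rfl
  rw [hf, sec_mul_right, sec, h]
  simp [sec, mul_assoc]

/-- The secondary action `▷'` as a morphism `E → Aut L`. -/
def secAut : E →* MulAut L where
  toFun e :=
    { toFun := A.sec e
      invFun := A.sec e⁻¹
      left_inv := fun l => by rw [← sec_mul_left, inv_mul_cancel, sec_one_left]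
      right_inv := fun l => by rw [← sec_mul_left, mul_inv_cancel, sec_one_left]
      map_mul' := A.sec_mul_right e }
  map_one' := by
    ext1 l
    exact A.sec_one_left l
  map_mul' e f := by
    ext1 l
    exact A.sec_mul_left e f l

theorem sec_eq (e : E) (l : L) : A.sec e l = A.secAut e l := rfl

theorem secAut_δ (k l : L) : A.secAut (A.δ k) l = k * l * k⁻¹ := A.sec_δ k l

theorem secAut_δ_symm (k l : L) : (A.secAut (A.δ k)).symm l = k⁻¹ * l * k := by
  rw [MulEquiv.symm_apply_eq, secAut_δ]
  group

theorem δ_secAut (e : E) (l : L) : A.δ (A.secAut e l) = e * A.δ l * e⁻¹ := by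
  rw [← sec_eq, sec, map_mul, δ_lift]
  simp [mul_assoc]

theorem actL_secAut (g : G) (e : E) (l : L) :
    A.actL g (A.secAut e l) = A.secAut (A.actE g e) (A.actL g l) := by
  simp [← sec_eq, sec, A.act_lift, A.δ_act]

theorem bd_actE_symm (g : G) (e : E) : A.bd ((A.actE g).symm e) = g⁻¹ * A.bd e * g := by
  simpa using A.bd_act g⁻¹ e

theorem δ_secAut_symm (e : E) (l : L) : A.δ ((A.secAut e).symm l) = e⁻¹ * A.δ l * e := by
  simpa using A.δ_secAut e⁻¹ l

theorem lift_δ_left (l : L) (e : E) : A.lift (A.δ l) e = l * A.secAut e l⁻¹ := by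
  simp [← sec_eq, sec]

theorem lift_δ_right (e : E) (l : L) :
    A.lift e (A.δ l) = A.secAut e l * (A.actL (A.bd e) l)⁻¹ := by
  have h := A.lift_δ_mul l e
  rw [lift_δ_left, mul_assoc] at h
  have h := mul_left_cancel h
  rw [map_inv, inv_mul_eq_iff_eq_mul] at h
  simpa using h

/-- `{e, fg} = ((e f e⁻¹) ▷' {e, g}) {e, f}`. -/
theorem lift_mul_right' (e f g : E) :
    A.lift e (f * g) = A.secAut (e * f * e⁻¹) (A.lift e g) * A.lift e f := by
  have h : e * f * e⁻¹ = A.δ (A.lift e f) * A.actE (A.bd e) f := by simp [δ_lift]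
  rw [h, map_mul, MulAut.mul_apply, secAut_δ, lift_mul_right, ← sec_eq, sec]
  simp [mul_assoc]

theorem lift_δ_mul_right (e f : E) (l : L) :
    A.lift e (A.δ l * f) = A.secAut e l * A.lift e f * (A.actL (A.bd e) l)⁻¹ := by
  rw [lift_mul_right', lift_δ_right]
  simp only [map_mul, MulAut.mul_apply, secAut_δ, map_inv, MulAut.apply_inv_self]
  simp [mul_assoc]

theorem lift_inv_right (e f : E) :
    A.lift e f⁻¹ = A.secAut (e * f⁻¹ * e⁻¹) (A.lift e f)⁻¹ := by
  have h := A.lift_mul_right' e f⁻¹ f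
  rw [inv_mul_cancel, lift_one_right] at h
  rw [map_inv]
  exact (inv_eq_of_mul_eq_one_right h.symm).symm

/-- `e⁻¹ ▷' {e, f} = {e⁻¹, ∂e ▷ f}⁻¹`. -/
theorem secAut_inv_lift (e f : E) :
    A.secAut e⁻¹ (A.lift e f) = (A.lift e⁻¹ (A.actE (A.bd e) f))⁻¹ := by
  have h := A.lift_mul_left e⁻¹ e f
  have h2 : e * f * e⁻¹ = A.δ (A.lift e f) * A.actE (A.bd e) f := by simp [δ_lift]
  rw [inv_mul_cancel, lift_one_left, h2, lift_δ_mul_right] at h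
  rw [eq_inv_iff_mul_eq_one]
  simpa using h.symm

/-- Passes from the product rule in the definition of a quadratic derivation to its shape in (3). -/
theorem secAut_mul_inv_lift (b x y : E) (l : L) :
    A.secAut (b * y)⁻¹ (A.lift b (A.actE (A.bd b)⁻¹ x⁻¹) * l) =
      A.secAut y⁻¹ ((A.lift b⁻¹ x⁻¹)⁻¹ * A.secAut b⁻¹ l) := by
  rw [mul_inv_rev, map_mul A.secAut, MulAut.mul_apply, map_mul (A.secAut b⁻¹), secAut_inv_lift]
  simp

/-- Left absorption of `δ`: `{p δ(l), q} = p ▷' (l (q ▷' l⁻¹)) {p, q}`. -/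
theorem lift_mul_δ_left (p q : E) (l : L) :
    A.lift (p * A.δ l) q = A.secAut p (l * A.secAut q l⁻¹) * A.lift p q := by
  have h : A.δ l * q * (A.δ l)⁻¹ = A.δ (l * A.secAut q l⁻¹) * q := by
    simp [δ_secAut, mul_assoc]
  rw [lift_mul_left, h, lift_δ_mul_right, lift_δ_left]
  simp [mul_assoc]

end Basic

/-! ### The Peiffer identity behind the target morphism -/

section Basic

variable {L E G : Type*} [Group L] [Group E] [Group G] (A : TwoCrossedModule L E G)

/-- The product of the conjugating factors in the image of the Peiffer lifting under a quadratic
derivation. -/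
theorem quadratic_conj_eq (a b x y : E) (l m : L) :
    A.secAut (a * x)⁻¹ (A.lift a (x * y⁻¹ * (A.actE (A.bd b)⁻¹ x)⁻¹) *
      A.actL (A.bd a) (A.secAut (x * y⁻¹) (A.lift b⁻¹ x⁻¹)⁻¹ * A.lift x (y⁻¹ * b⁻¹) *
        A.actL (A.bd x) m)) * l =
    A.secAut y⁻¹ (A.lift b⁻¹ x⁻¹)⁻¹ *
      A.secAut (a * x * (b * y))⁻¹ (A.lift a b * (A.lift (a * x) (b * y))⁻¹) *
      A.secAut (a * x)⁻¹ (A.actL (A.bd (a * x)) m) * l := by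
  set z := A.lift b⁻¹ x⁻¹ with hz
  have h1 : (A.actE (A.bd b)⁻¹ x)⁻¹ = A.δ z⁻¹ * (b⁻¹ * x⁻¹ * b) := by
    simp [hz, δ_lift, mul_assoc]
  have h2 : A.lift a (x * y⁻¹ * (A.actE (A.bd b)⁻¹ x)⁻¹) *
      A.actL (A.bd a) (A.secAut (x * y⁻¹) z⁻¹) =
      A.secAut (a * (x * y⁻¹)) z⁻¹ * A.lift a (x * y⁻¹ * (b⁻¹ * x⁻¹ * b)) := by
    have hc : a * (x * y⁻¹) * a⁻¹ = A.δ (A.lift a (x * y⁻¹)) * A.actE (A.bd a) (x * y⁻¹) := by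
      rw [δ_lift, map_inv, inv_mul_cancel_right]
    rw [h1, lift_mul_right', lift_δ_mul_right, lift_mul_right' _ _ (x * y⁻¹), actL_secAut]
    have hd : A.secAut (A.actE (A.bd a) (x * y⁻¹)) (A.actL (A.bd a) z⁻¹) =
      (A.lift a (x * y⁻¹))⁻¹ * A.secAut (a * (x * y⁻¹) * a⁻¹) (A.actL (A.bd a) z⁻¹) *
        A.lift a (x * y⁻¹) := by
      rw [hc, map_mul A.secAut, MulAut.mul_apply, secAut_δ]
      group
    rw [hd]
    simp [mul_assoc]
  have h3 : A.lift a (x * y⁻¹ * (b⁻¹ * x⁻¹ * b)) * A.actL (A.bd a) (A.lift x (y⁻¹ * b⁻¹)) =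
      A.secAut (a * x * (b * y)⁻¹ * (a * x)⁻¹)
        (A.lift a b * (A.lift (a * x) (b * y))⁻¹) := by
    -- Once `b` is split off, `{a, x q x⁻¹}` and `∂a ▷ {x, q}` with `q = (by)⁻¹` merge into `{ax,
    -- q}` by left expansion.
    have e1 : x * y⁻¹ * (b⁻¹ * x⁻¹ * b) = x * (y⁻¹ * b⁻¹) * x⁻¹ * b := by group
    rw [e1, lift_mul_right', mul_assoc, ← lift_mul_left, ← mul_inv_rev b y, lift_inv_right]
    simp [mul_assoc]
  simp only [map_mul (A.actL (A.bd a))]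
  have h4 : ∀ u v w c : L, u * (v * w * c) = (u * v) * w * c := by intros; group
  rw [h4, h2, mul_assoc (A.secAut (a * (x * y⁻¹)) z⁻¹), h3]
  simp [mul_assoc]

/-- Used with `x = s(∂a)`, `y = s(∂b)`, `l = t(a)`, `m = t(b)`: the left side is then `{a, b}` times
the value found for `t(δ{a, b})`. -/
theorem lift_quadratic_aux (a b x y : E) (l m : L) :
    A.lift a b * A.secAut (A.actE (A.bd a) b * a * (A.actE (A.bd b)⁻¹ x * y))
      (A.secAut y⁻¹ ((A.lift b⁻¹ x⁻¹)⁻¹ * A.secAut b⁻¹ l) * m *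
        (A.secAut (a * x)⁻¹ (A.lift a (x * y⁻¹ * (A.actE (A.bd b)⁻¹ x)⁻¹) *
          A.actL (A.bd a) (A.secAut (x * y⁻¹) (A.lift b⁻¹ x⁻¹)⁻¹ * A.lift x (y⁻¹ * b⁻¹) *
            A.actL (A.bd x) m)) * l)⁻¹) =
    A.lift (a * x * A.δ l) (b * y * A.δ m) := by
  rw [quadratic_conj_eq, lift_mul_δ_left, A.lift_mul_right' (a * x) (b * y) (A.δ m), lift_δ_right]
  generalize A.lift (a * x) (b * y) = c
  have h1 : A.actE (A.bd b)⁻¹ x = (b⁻¹ * x * b) * A.δ (A.lift b⁻¹ x⁻¹) := by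
    simp [δ_lift, mul_assoc]
  have h2 : A.actE (A.bd a) b = (A.δ (A.lift a b))⁻¹ * a * b * a⁻¹ := by
    simp [δ_lift, mul_assoc]
  rw [h1, h2]
  simp [mul_assoc, secAut_δ, secAut_δ_symm]

end Basic

/-! ### Quadratic derivations and their target morphisms -/

section Quadratic

variable {L E G : Type*} [Group L] [Group E] [Group G]
variable {L' E' G' : Type*} [Group L'] [Group E'] [Group G']
variable {A : TwoCrossedModule L E G} {A' : TwoCrossedModule L' E' G'}

theorem IsDerivation.map_one {φ : G →* G'} {s : G → E'} (h : IsDerivation A' φ s) : s 1 = 1 := by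
  simpa using h 1 1

theorem IsDerivation.map_inv {φ : G →* G'} {s : G → E'} (h : IsDerivation A' φ s) (g : G) :
    s g⁻¹ = (A'.actE (φ g) (s g))⁻¹ := by
  have := h g g⁻¹
  rw [mul_inv_cancel, h.map_one] at this
  rw [eq_inv_iff_mul_eq_one, mul_eq_one_comm]
  simpa using this.symm

theorem IsDerivation.bd_mul {φ : G →* G'} {s : G → E'} (h : IsDerivation A' φ s) (g k : G) :
    φ (g * k) * A'.bd (s (g * k)) = φ g * A'.bd (s g) * (φ k * A'.bd (s k)) := by
  rw [h]
  simp [bd_actE_symm, mul_assoc]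

namespace IsQuadraticDerivation

variable {f : Hom A A'} {s : G → E'} {t : E → L'} (h : IsQuadraticDerivation f s t)
include h

theorem map_mul' (a b : E) : t (a * b) =
    A'.secAut (s (A.bd b))⁻¹
      ((A'.lift (f.ψ b)⁻¹ (s (A.bd a))⁻¹)⁻¹ * A'.secAut (f.ψ b)⁻¹ (t a)) * t b := by
  rw [h.mul, sec_eq, map_inv f.φ, ← f.bd_comm, secAut_mul_inv_lift]

theorem map_one : t 1 = 1 := by
  simpa [h.deriv.map_one] using h.map_mul' 1 1

theorem map_δ_mul (l : L) (b : E) : t (A.δ l * b) =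
    A'.secAut (f.ψ b * s (A.bd b))⁻¹ (t (A.δ l)) * t b := by
  rw [h.map_mul']
  simp [h.deriv.map_one]

/-- Expand `t(ab)` twice, directly and through `ab = δ{a,b} (∂a ▷ b) a`, and solve for `t(δ{a,b})`.
-/
theorem map_δ_lift (a b : E) : f.μ (A.lift a b) * t (A.δ (A.lift a b)) =
    A'.lift (f.ψ a * s (A.bd a) * A'.δ (t a)) (f.ψ b * s (A.bd b) * A'.δ (t b)) := by
  have h1 : a * b = A.δ (A.lift a b) * (A.actE (A.bd a) b * a) := by
    simp [δ_lift]
  have h2 := h.map_mul' a b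
  rw [h1, h.map_δ_mul, h.mul, h.act] at h2
  rw [← lift_quadratic_aux, ← f.map_lift]
  have hs : s (A.bd (A.actE (A.bd a) b * a)) =
      A'.actE (f.φ (A.bd b))⁻¹ (s (A.bd a)) * s (A.bd b) := by
    rw [← h.deriv]
    simp
  have hs2 : A'.actE (f.φ (A.bd a)⁻¹) (s (A.bd (A.actE (A.bd a) b)))⁻¹ =
      s (A.bd a) * (s (A.bd b))⁻¹ * (A'.actE (f.φ (A.bd b))⁻¹ (s (A.bd a)))⁻¹ := by
    rw [bd_act, h.deriv, h.deriv, h.deriv.map_inv]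
    simp [mul_assoc]
  rw [hs, hs2, ← eq_mul_inv_iff_mul_eq] at h2
  simp only [sec_eq] at h2
  have h3 : ∀ (e : E') (k l : L'), A'.secAut e⁻¹ k = l → k = A'.secAut e l := by
    rintro e k l rfl
    simp
  have h4 := h3 _ _ _ h2
  rw [h4]
  simp only [f.bd_comm, map_mul f.ψ, f.map_actE, map_mul (A'.actL (f.φ (A.bd a))),
    MulAut.mul_apply, map_mul A'.actL]

/-- The morphism at the other end of the homotopy given by a quadratic `f`-derivation. -/
def target : Hom A A' where
  μ := MonoidHom.mk' (fun l => f.μ l * t (A.δ l)) fun l k => by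
    have h1 : s (A.bd (A.δ k)) = 1 := by simp [h.deriv.map_one]
    rw [map_mul A.δ, h.map_δ_mul, h1, mul_one, ← f.δ_comm, ← map_inv, secAut_δ]
    simp [mul_assoc]
  ψ := MonoidHom.mk' (fun a => f.ψ a * s (A.bd a) * A'.δ (t a)) fun a b => by
    rw [map_mul A.bd, h.deriv, h.mul, sec_eq]
    simp [δ_secAut_symm, δ_lift, f.bd_comm, mul_assoc]
  φ := MonoidHom.mk' (fun g => f.φ g * A'.bd (s g)) h.deriv.bd_mul
  δ_comm l := by simp [f.δ_comm, h.deriv.map_one]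
  bd_comm a := by simp [f.bd_comm]
  map_lift := h.map_δ_lift
  map_actL g l := by
    have h1 : A'.lift (f.ψ (A.δ l))⁻¹ (s g)⁻¹ =
        (f.μ l)⁻¹ * A'.secAut (s g)⁻¹ (f.μ l) := by
      rw [← f.δ_comm, ← map_inv A'.δ, lift_δ_left, inv_inv]
    have h2 : A'.lift (s g) (f.ψ (A.δ l))⁻¹ =
        A'.secAut (s g) (f.μ l)⁻¹ * A'.actL (A'.bd (s g)) (f.μ l) := by
      rw [← f.δ_comm, ← map_inv A'.δ, lift_δ_right, map_inv (A'.actL _), inv_inv]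
    simp [A.δ_act, h.act, h.deriv.map_one, sec_eq, h1, h2, f.map_actL, mul_assoc]
  map_actE g a := by
    simp [h.act, sec_eq, δ_secAut, δ_secAut_symm, δ_lift, A'.δ_act, h.deriv _ _,
      h.deriv.map_inv, f.map_actE, f.bd_comm, mul_assoc]

end IsQuadraticDerivation

end Quadratic

/-! ### Factor systems, their extensions and the free group -/

/-- A nonabelian factor system of a group `G` with values in a group `N`. -/
structure FactorSystem (G N : Type*) [Group G] [Group N] where
  aut : G → MulAut N
  coc : G → G → N
  coc_mul : ∀ g h i, aut i (coc g h) * coc (g * h) i = coc h i * coc g (h * i)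
  aut_aut : ∀ h i n, aut i (aut h n) * coc h i = coc h i * aut (h * i) n

namespace FactorSystem

variable {G N : Type*} [Group G] [Group N] (c : FactorSystem G N)

theorem aut_one (n : N) : c.aut 1 n = c.coc 1 1 * n * (c.coc 1 1)⁻¹ := by
  obtain ⟨m, rfl⟩ := (c.aut 1).surjective n
  rw [eq_mul_inv_iff_mul_eq, c.aut_aut, mul_one]

theorem coc_one_right (g : G) : c.coc g 1 = c.coc 1 1 := by
  have h := c.coc_mul g 1 1
  rw [mul_one, mul_one, aut_one, mul_left_inj, mul_inv_eq_iff_eq_mul] at h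
  exact mul_left_cancel h

theorem coc_one_left (i : G) : c.coc 1 i = c.aut i (c.coc 1 1) := by
  have h := c.coc_mul 1 1 i
  rw [one_mul, one_mul, mul_left_inj] at h
  exact h.symm

theorem aut_inv_aut (g : G) (n : N) : c.aut g⁻¹ (c.aut g n) =
    c.coc g g⁻¹ * c.coc 1 1 * n * (c.coc g g⁻¹ * c.coc 1 1)⁻¹ := by
  have h := c.aut_aut g g⁻¹ n
  rw [mul_inv_cancel, aut_one, ← eq_mul_inv_iff_mul_eq] at h
  rw [h]
  group

/-- The group extension of `G` by `Nᵐᵒᵖ` defined by a factor system. -/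
@[ext] structure Ext (c : FactorSystem G N) where
  fst : G
  snd : N

namespace Ext

instance : Mul c.Ext := ⟨fun x y => ⟨x.fst * y.fst, y.snd * c.aut y.fst x.snd * c.coc x.fst y.fst⟩⟩

-- The cocycle is not normalised; this correction becomes the `Π(1,1)⁻¹` in the formula for `μ₂`.
instance : One c.Ext := ⟨⟨1, (c.coc 1 1)⁻¹⟩⟩

instance : Inv c.Ext := ⟨fun x => ⟨x.fst⁻¹,
  (c.aut x.fst).symm (x.snd⁻¹ * (c.coc 1 1)⁻¹ * (c.coc x.fst⁻¹ x.fst)⁻¹)⟩⟩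

theorem mul_fst (x y : c.Ext) : (x * y).fst = x.fst * y.fst := rfl

theorem mul_snd (x y : c.Ext) :
    (x * y).snd = y.snd * c.aut y.fst x.snd * c.coc x.fst y.fst := rfl

theorem one_fst : (1 : c.Ext).fst = 1 := rfl

theorem one_snd : (1 : c.Ext).snd = (c.coc 1 1)⁻¹ := rfl

theorem inv_fst (x : c.Ext) : x⁻¹.fst = x.fst⁻¹ := rfl

theorem inv_snd (x : c.Ext) : x⁻¹.snd =
    (c.aut x.fst).symm (x.snd⁻¹ * (c.coc 1 1)⁻¹ * (c.coc x.fst⁻¹ x.fst)⁻¹) := rfl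

instance : Group c.Ext := Group.ofLeftAxioms
  (fun x y z => by
    ext
    · exact mul_assoc _ _ _
    · have h1 := c.coc_mul x.fst y.fst z.fst
      have h2 := c.aut_aut y.fst z.fst x.snd
      simp only [mul_snd, mul_fst, map_mul]
      rw [mul_assoc _ _ (c.coc (x.fst * y.fst) z.fst), mul_assoc _ _ (c.coc (x.fst * y.fst) z.fst),
        h1, mul_assoc z.snd, mul_assoc (c.aut z.fst y.snd),
        ← mul_assoc (c.aut z.fst (c.aut y.fst x.snd)), h2]
      simp only [mul_assoc])
  (fun x => by
    ext
    · exact one_mul _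
    · rw [mul_snd, one_snd, one_fst, c.coc_one_left x.fst, map_inv, inv_mul_cancel_right])
  (fun x => by
    ext
    · exact inv_mul_cancel _
    · simp [mul_snd, one_snd, inv_snd, inv_fst, mul_assoc])

/-- The morphism from the free group that maps `[g]` to `(g, 1)`. -/
def ofFree : FreeGroup G →* c.Ext := FreeGroup.lift fun g => ⟨g, 1⟩

theorem ofFree_fst (u : FreeGroup G) : (ofFree c u).fst = freeProj G u := by
  let q : c.Ext →* G := MonoidHom.mk' Ext.fst (mul_fst c)
  have h : q.comp (ofFree c) = freeProj G := by
    ext g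
    simp [q, ofFree, freeProj]
  exact DFunLike.congr_fun h u

end Ext

/-- The second component of the morphism from the free group to the extension. -/
def freeCoc (u : FreeGroup G) : N := (Ext.ofFree c u).snd

theorem freeCoc_of (g : G) : c.freeCoc (FreeGroup.of g) = 1 := by
  simp [freeCoc, Ext.ofFree]

theorem freeCoc_one : c.freeCoc 1 = (c.coc 1 1)⁻¹ := by
  simp [freeCoc, Ext.one_snd]

theorem freeCoc_mul (u v : FreeGroup G) : c.freeCoc (u * v) =
    c.freeCoc v * c.aut (freeProj G v) (c.freeCoc u) * c.coc (freeProj G u) (freeProj G v) := by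
  simp [freeCoc, Ext.mul_snd, Ext.ofFree_fst]

/-- Evaluating on `[gh] r = [g][h]` in two ways avoids the formula for inverses. -/
theorem freeCoc_relator (g h : G) :
    c.freeCoc ((FreeGroup.of (g * h))⁻¹ * FreeGroup.of g * FreeGroup.of h) =
      c.coc g h * (c.coc 1 1)⁻¹ := by
  have h1 := c.freeCoc_mul (FreeGroup.of (g * h))
    ((FreeGroup.of (g * h))⁻¹ * FreeGroup.of g * FreeGroup.of h)
  have h2 : freeProj G ((FreeGroup.of (g * h))⁻¹ * FreeGroup.of g * FreeGroup.of h) = 1 := by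
    simp [freeProj, mul_assoc]
  rw [h2, freeCoc_of, ← mul_assoc, ← mul_assoc, mul_inv_cancel, one_mul, freeCoc_mul, freeCoc_of,
    freeCoc_of, coc_one_right] at h1
  rw [eq_mul_inv_iff_mul_eq]
  simpa [freeProj] using h1.symm

/-- The last factor is the product of `Π`-terms in (4); the first is the one that `act_twist` splits
off. -/
theorem freeCoc_conj (u v : FreeGroup G) : c.freeCoc (u * v * u⁻¹) =
    (c.aut (freeProj G u)).symm
      ((c.freeCoc u)⁻¹ * c.freeCoc v * c.aut (freeProj G v) (c.freeCoc u)) *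
    ((c.coc 1 1)⁻¹ * (c.coc (freeProj G u) (freeProj G u)⁻¹)⁻¹ *
      c.coc (freeProj G v) (freeProj G u)⁻¹ *
      c.coc (freeProj G u) (freeProj G v * (freeProj G u)⁻¹)) := by
  have h1 := c.freeCoc_mul u u⁻¹
  have h2 := c.coc_mul (freeProj G u) (freeProj G v) (freeProj G u)⁻¹
  rw [mul_inv_cancel, freeCoc_one, map_inv] at h1
  rw [freeCoc_mul, freeCoc_mul, map_mul (freeProj G), map_inv (freeProj G)]
  generalize freeProj G u = g at *
  generalize freeProj G v = h at *
  have h3 (n : N) : c.aut g⁻¹ n = c.coc g g⁻¹ * c.coc 1 1 * (c.aut g).symm n *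
      (c.coc g g⁻¹ * c.coc 1 1)⁻¹ := by
    rw [← aut_inv_aut, MulEquiv.apply_symm_apply]
  have h4 : c.freeCoc u⁻¹ = (c.coc 1 1)⁻¹ * (c.coc g g⁻¹)⁻¹ * (c.aut g⁻¹ (c.freeCoc u))⁻¹ := by
    rw [h1]
    group
  rw [mul_assoc _ (c.coc h g⁻¹), ← h2, h4, map_mul (c.aut g⁻¹) _ (c.coc g h)]
  simp only [h3, map_mul, map_inv]
  group

end FactorSystem

/-! ### Derivations on free groups -/

section FreeDerivation

variable {X L E G : Type*} [Group L] [Group E] [Group G] {A : TwoCrossedModule L E G}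
  {φ : FreeGroup X →* G}

theorem IsDerivation.ext_of {s s' : FreeGroup X → E} (h : IsDerivation A φ s)
    (h' : IsDerivation A φ s') (hs : ∀ x, s (FreeGroup.of x) = s' (FreeGroup.of x)) : s = s' := by
  funext u
  induction u using FreeGroup.induction_on with
  | C1 => rw [h.map_one, h'.map_one]
  | of x => exact hs x
  | inv_of x hx => rw [h.map_inv, h'.map_inv, hx]
  | mul u v hu hv => rw [h, h', hu, hv]

theorem exists_isDerivation (A : TwoCrossedModule L E G) (φ : FreeGroup X →* G) (s : X → E) :
    ∃ s' : FreeGroup X → E, IsDerivation A φ s' ∧ ∀ x, s' (FreeGroup.of x) = s x := by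
  -- A derivation `s` is the same as the lift `u ↦ φ(u) s(u)` of `φ` to the semidirect product.
  let Φ : FreeGroup X →* E ⋊[A.actE] G := FreeGroup.lift fun x =>
    SemidirectProduct.inr (φ (FreeGroup.of x)) * SemidirectProduct.inl (s x)
  have hΦ (u : FreeGroup X) : (Φ u).right = φ u := by
    have : SemidirectProduct.rightHom.comp Φ = φ := by
      ext x
      simp [Φ]
    exact DFunLike.congr_fun this u
  refine ⟨fun u => A.actE (φ u)⁻¹ (Φ u).left, fun u v => ?_, fun x => ?_⟩
  · simp [hΦ]
  · simp [Φ]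

end FreeDerivation

/-! ### Generators and relations of the pullback -/

section Generators

variable {L E G : Type*} [Group L] [Group E] [Group G] (A : TwoCrossedModule L E G)

theorem freeProj_of (g : G) : freeProj G (FreeGroup.of g) = g := by simp [freeProj]

theorem genE_mul_genE (a b : E) :
    A.genE a * A.genE b = A.genE (a * b) * A.genG (A.bd a) (A.bd b) := by
  apply Subtype.ext
  simp [genE, genG, mul_assoc]

theorem genG_mul_genG (g h i : G) :
    A.genG g (h * i) * A.genG h i =
      A.genG (g * h) i * A.resolution.actE (FreeGroup.of i)⁻¹ (A.genG g h) := by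
  apply Subtype.ext
  change (_, _) = ((_ : E), (_ : FreeGroup G))
  simp [genG, resolution, pullbackAct, pullbackActFun, mul_assoc]

/-- The factors stand in the reverse of their order in (4), because `t` reverses products with
kernel elements. -/
theorem actE_genE (g : G) (a : E) :
    A.resolution.actE (FreeGroup.of g) (A.genE a) = A.genE (A.actE g a) *
      (A.genG g (A.bd a * g⁻¹) * (A.genG (A.bd a) g⁻¹ * ((A.genG g g⁻¹)⁻¹ * (A.genG 1 1)⁻¹))) := by
  apply Subtype.ext
  simp [genG, genE, resolution, pullbackAct, pullbackActFun, freeProj, mul_assoc]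

/-- The element `(1, [p u]⁻¹ u)` of `E ×_{∂,p} F(G)`. -/
def genK (u : FreeGroup G) : A.pullback :=
  ⟨(1, (FreeGroup.of (freeProj G u))⁻¹ * u), by simp [mem_pullback, freeProj_of]⟩

theorem genK_one : A.genK 1 = (A.genG 1 1)⁻¹ := by
  apply Subtype.ext
  simp [genK, genG]

theorem genK_of_mul (g : G) (u : FreeGroup G) :
    A.genK (FreeGroup.of g * u) = A.genG g (freeProj G u) * A.genK u := by
  apply Subtype.ext
  simp [genK, genG, freeProj_of, mul_assoc]

theorem genK_of_inv_mul (g : G) (u : FreeGroup G) :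
    A.genK ((FreeGroup.of g)⁻¹ * u) = (A.genG g (g⁻¹ * freeProj G u))⁻¹ * A.genK u := by
  apply Subtype.ext
  simp [genK, genG, freeProj_of, mul_assoc]

theorem genE_mul_genK (x : A.pullback) : A.genE x.1.1 * A.genK x.1.2 = x := by
  have hx := (A.mem_pullback _).1 x.2
  apply Subtype.ext
  simp [genK, genE, hx]

theorem closure_generators :
    Subgroup.closure (Set.range A.genE ∪ Set.range fun x : G × G => A.genG x.1 x.2) = ⊤ := by
  set S := Subgroup.closure (Set.range A.genE ∪ Set.range fun x : G × G => A.genG x.1 x.2)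
  have hE (e : E) : A.genE e ∈ S := Subgroup.subset_closure (Or.inl ⟨e, rfl⟩)
  have hG (g h : G) : A.genG g h ∈ S := Subgroup.subset_closure (Or.inr ⟨(g, h), rfl⟩)
  -- Left multiplication of `u` by `[g]^±1` changes `genK u` only by a generator or its inverse; `v`
  -- is kept general for the induction over products.
  have hK (u v : FreeGroup G) (hv : A.genK v ∈ S) : A.genK (u * v) ∈ S := by
    induction u using FreeGroup.induction_on generalizing v with
    | C1 => simpa using hv
    | of g => simpa only [genK_of_mul] using S.mul_mem (hG _ _) hv
    | inv_of g _ => simpa only [genK_of_inv_mul] using S.mul_mem (S.inv_mem (hG _ _)) hv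
    | mul u w hu hw => simpa only [mul_assoc] using hu _ (hw _ hv)
  rw [eq_top_iff]
  intro x _
  rw [← A.genE_mul_genK x]
  refine S.mul_mem (hE _) ?_
  simpa using hK x.1.2 1 (by simpa only [genK_one] using S.inv_mem (hG 1 1))

end Generators

/-! ### Uniqueness of quadratic derivations -/

section Quadratic

variable {L E G : Type*} [Group L] [Group E] [Group G]
variable {L' E' G' : Type*} [Group L'] [Group E'] [Group G']
variable {A : TwoCrossedModule L E G} {A' : TwoCrossedModule L' E' G'}

/-- A quadratic derivation is determined by its values on a generating set. -/
theorem IsQuadraticDerivation.eq_of_closure {f : Hom A A'} {s : G → E'} {t t' : E → L'}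
    (h : IsQuadraticDerivation f s t) (h' : IsQuadraticDerivation f s t') {S : Set E}
    (hS : Subgroup.closure S = ⊤) (ht : Set.EqOn t t' S) : t = t' := by
  funext x
  have hx : x ∈ Subgroup.closure S := hS ▸ Subgroup.mem_top x
  induction hx using Subgroup.closure_induction with
  | mem x hx => exact ht hx
  | one => rw [h.map_one, h'.map_one]
  | mul x y _ _ hx hy => rw [h.map_mul', h'.map_mul', hx, hy]
  | inv x _ hx =>
    have h1 := h.map_mul' x x⁻¹
    have h2 := h'.map_mul' x x⁻¹
    rw [mul_inv_cancel, h.map_one] at h1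
    rw [mul_inv_cancel, h'.map_one, ← hx, h1] at h2
    exact mul_left_cancel h2

end Quadratic

/-! ### From lax homotopies to triples -/

section Lax

variable {L E G : Type*} [Group L] [Group E] [Group G]
variable {L' E' G' : Type*} [Group L'] [Group E'] [Group G']
variable {A : TwoCrossedModule L E G} {A' : TwoCrossedModule L' E' G'}

namespace IsLaxHomotopy

variable {f₁ f₂ : Hom A A'} {s : FreeGroup G → E'} {t : A.pullback → L'}
  (h : IsLaxHomotopy f₁ f₂ s t)
include h

/-- Both end morphisms factor through `proj`, hence are trivial on `k`. -/
theorem s_ker {k : A.pullback} (hk : k.1.1 = 1) : s k.1.2 = (A'.δ (t k))⁻¹ := by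
  have h1 : f₂.ψ k.1.1 = f₁.ψ k.1.1 * s k.1.2 * A'.δ (t k) := h.ψ_eq k
  rw [hk, map_one, map_one, one_mul] at h1
  exact eq_inv_of_mul_eq_one_left h1.symm

/-- By `s_ker`, the twist in the product rule is conjugation by `t k`, which swaps the factors. -/
theorem t_mul_ker (x : A.pullback) {k : A.pullback} (hk : k.1.1 = 1) :
    t (x * k) = t k * t x := by
  have h1 : (f₁.comp A.proj).ψ k = 1 := by simp [Hom.comp, proj, hk]
  have h2 : s (A.resolution.bd k) = (A'.δ (t k))⁻¹ := h.s_ker hk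
  rw [h.quadratic.map_mul', h1, h2]
  simp [secAut_δ]

theorem t_inv_ker {k : A.pullback} (hk : k.1.1 = 1) : t k⁻¹ = (t k)⁻¹ := by
  have h1 := h.t_mul_ker k⁻¹ hk
  rw [inv_mul_cancel, h.quadratic.map_one] at h1
  exact eq_inv_of_mul_eq_one_right h1.symm

theorem t_act_ker (u : FreeGroup G) {k : A.pullback} (hk : k.1.1 = 1) :
    t (A.resolution.actE u k) =
      A'.actL (f₁.φ (freeProj G u)) (A'.secAut (s u) (t k)) := by
  have h1 : (f₁.comp A.proj).ψ k = 1 := by simp [Hom.comp, proj, hk]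
  have h2 : s (A.resolution.bd k) = (A'.δ (t k))⁻¹ := h.s_ker hk
  have h3 : (f₁.comp A.proj).φ u = f₁.φ (freeProj G u) := rfl
  rw [h.quadratic.act, h1, h2, h3]
  simp [sec_eq, lift_δ_right]

theorem isLaxTriple : IsLaxTriple f₁ (A.restrict (s, t)).1 (A.restrict (s, t)).2.1
    (A.restrict (s, t)).2.2 := by
  have hd := h.quadratic.deriv
  have hφ (g : G) : (f₁.comp A.proj).φ (FreeGroup.of g) = f₁.φ g := by
    simp [Hom.comp, proj, freeProj_of]
  have lax2 : ∀ g k, s (FreeGroup.of (g * k)) = A'.actE (f₁.φ k)⁻¹ (s (FreeGroup.of g)) *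
      s (FreeGroup.of k) * A'.δ (t (A.genG g k)) := by
    intro g k
    have h1 : s (A.genG g k).1.2 = (A'.δ (t (A.genG g k)))⁻¹ := h.s_ker rfl
    have h2 := hd (FreeGroup.of (g * k)) (A.genG g k).1.2
    have h3 : (f₁.comp A.proj).φ (A.genG g k).1.2 = 1 := by
      simp [Hom.comp, proj, genG, freeProj_of]
    have h4 : FreeGroup.of (g * k) * (A.genG g k).1.2 = FreeGroup.of g * FreeGroup.of k := by
      simp [genG, mul_assoc]
    rw [h3, h1, h4, hd, hφ] at h2
    rw [h2]
    simp
  refine ⟨fun g k => ?_, lax2, fun a b => ?_, fun g a => ?_, fun g k i => ?_⟩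
  · change A'.bd (s (FreeGroup.of (g * k))) = _
    rw [lax2]
    simp [restrict]
  · have h1 := h.quadratic.map_mul' (A.genE a) (A.genE b)
    rw [genE_mul_genE, h.t_mul_ker _ rfl] at h1
    exact h1
  · have h1 := h.quadratic.act (FreeGroup.of g) (A.genE a)
    rw [actE_genE, h.t_mul_ker _ (by simp [genG]), h.t_mul_ker _ (by simp [genG]),
      h.t_mul_ker _ (by simp [genG]), h.t_mul_ker _ (by simp [genG]), h.t_inv_ker rfl,
      h.t_inv_ker rfl, hφ] at h1
    exact h1.symm
  · have h1 := congrArg t (A.genG_mul_genG g k i)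
    have hc : (A.resolution.actE (FreeGroup.of i)⁻¹ (A.genG g k)).1.1 = 1 :=
      map_one (A.actE (freeProj G (FreeGroup.of i)⁻¹))
    rw [h.t_mul_ker _ rfl, h.t_mul_ker _ hc, h.t_act_ker _ rfl,
      hd.map_inv, map_inv (freeProj G), freeProj_of, map_inv f₁.φ, actL_secAut, map_inv (A'.actE _),
      ← hφ, map_inv, map_inv A'.actE, MulAut.inv_apply_self, hφ,
      ← map_inv A'.secAut] at h1
    exact h1.symm

theorem isLaxTarget : IsLaxTarget f₁ f₂ (A.restrict (s, t)).1 (A.restrict (s, t)).2.1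
    (A.restrict (s, t)).2.2 where
  φ_eq g := by
    have h1 := h.φ_eq (FreeGroup.of g)
    simpa [Hom.comp, proj, freeProj_of, restrict] using h1
  ψ_eq e := h.ψ_eq (A.genE e)
  μ_eq l := by
    -- `genE (δ l)` has second coordinate `[1]`, and `genG 1 1 = (1, [1])` removes it.
    have h1 : A.pullbackδ l = A.genE (A.δ l) * (A.genG 1 1)⁻¹ := by
      apply Subtype.ext
      simp [genE, genG]
    have h2 := h.μ_eq l
    change f₂.μ l = f₁.μ l * t (A.pullbackδ l) at h2
    rw [h2, h1, h.t_mul_ker _ (by simp [genG]), h.t_inv_ker rfl, ← mul_assoc]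
    rfl

end IsLaxHomotopy

theorem injOn_restrict (f₁ f₂ : Hom A A') : Set.InjOn A.restrict
    {st : (FreeGroup G → E') × (A.pullback → L') | IsLaxHomotopy f₁ f₂ st.1 st.2} := by
  rintro ⟨s, t⟩ h ⟨s', t'⟩ h' heq
  simp only [restrict, Prod.mk.injEq, funext_iff, Prod.forall] at heq
  obtain ⟨hs, hE, hG⟩ := heq
  obtain rfl : s = s' := h.quadratic.deriv.ext_of h'.quadratic.deriv hs
  refine Prod.ext rfl (h.quadratic.eq_of_closure h'.quadratic A.closure_generators ?_)
  rintro _ (⟨e, rfl⟩ | ⟨x, rfl⟩)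
  · exact hE e
  · exact hG x.1 x.2

end Lax

/-! ### Change of the action formula under twisting by `δ` -/

section Twist

variable {L E G : Type*} [Group L] [Group E] [Group G] (A : TwoCrossedModule L E G)

theorem lift_inv_mul_δ_inv (a x : E) (k : L) : A.lift a⁻¹ (x * (A.δ k)⁻¹)⁻¹ =
    A.secAut a⁻¹ k * A.lift a⁻¹ x⁻¹ * (A.actL (A.bd a)⁻¹ k)⁻¹ := by
  rw [mul_inv_rev, inv_inv, lift_δ_mul_right, map_inv A.bd]

/-- Behaviour of the action formula of a quadratic derivation when `x`, `y` and `l` are replaced by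
`x δ(k)⁻¹`, `y δ(m)⁻¹` and `m l`. -/
theorem act_twist (a x y : E) (k m l : L) :
    A.secAut (x * (A.δ k)⁻¹ * (y * (A.δ m)⁻¹)⁻¹) (A.lift a⁻¹ (x * (A.δ k)⁻¹)⁻¹)⁻¹ *
      A.lift (x * (A.δ k)⁻¹) ((y * (A.δ m)⁻¹)⁻¹ * a⁻¹) *
      A.actL (A.bd (x * (A.δ k)⁻¹)) (m * l) =
    A.secAut x (k⁻¹ * m * A.secAut y⁻¹ (A.actL (A.bd a)⁻¹ k)) *
      (A.secAut (x * y⁻¹) (A.lift a⁻¹ x⁻¹)⁻¹ * A.lift x (y⁻¹ * a⁻¹) * A.actL (A.bd x) l) := by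
  have h2 : A.lift (x * (A.δ k)⁻¹) ((y * (A.δ m)⁻¹)⁻¹ * a⁻¹) =
      A.secAut x (k⁻¹ * A.secAut ((y * (A.δ m)⁻¹)⁻¹ * a⁻¹) k) *
        (A.secAut x m * A.lift x (y⁻¹ * a⁻¹) * (A.actL (A.bd x) m)⁻¹) := by
    rw [← map_inv, lift_mul_δ_left, inv_inv, mul_inv_rev, inv_inv, mul_assoc, lift_δ_mul_right]
  rw [lift_inv_mul_δ_inv, h2]
  simp [mul_assoc, secAut_δ, secAut_δ_symm]

end Twist

/-! ### From triples to quadratic derivations -/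

namespace IsLaxTriple

variable {L E G : Type*} [Group L] [Group E] [Group G]
variable {L' E' G' : Type*} [Group L'] [Group E'] [Group G']
variable {A : TwoCrossedModule L E G} {A' : TwoCrossedModule L' E' G'}
variable {f : Hom A A'} {s : G → E'} {t : E → L'} {P : G × G → L'} (h : IsLaxTriple f s t P)
include h

/-- The factor system of a lax triple. -/
def factorSystem : FactorSystem G L' where
  aut g := A'.secAut (s g)⁻¹ * A'.actL (f.φ g)⁻¹
  coc g k := P (g, k)
  coc_mul := h.lax5
  aut_aut g k l := by
    have h1 := h.lax2 g k
    rw [h1]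
    simp [mul_assoc, secAut_δ, ← map_inv, actL_secAut]

theorem factorSystem_aut (g : G) (l : L') :
    h.factorSystem.aut g l = A'.secAut (s g)⁻¹ (A'.actL (f.φ g)⁻¹ l) := rfl

theorem factorSystem_aut_symm (g : G) (l : L') :
    (h.factorSystem.aut g).symm l = A'.actL (f.φ g) (A'.secAut (s g) l) := by
  rw [MulEquiv.symm_apply_eq, factorSystem_aut]
  simp

theorem factorSystem_coc (g k : G) : h.factorSystem.coc g k = P (g, k) := rfl

/-- The extension of `ŝ` to the free group. -/
def freeS (u : FreeGroup G) : E' :=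
  s (freeProj G u) * (A'.δ (h.factorSystem.freeCoc u))⁻¹

/-- The extension of `t̂` and `Π` to the pullback. -/
def freeT (x : A.pullback) : L' := h.factorSystem.freeCoc x.1.2 * t x.1.1

/-- By (2), `ŝ(1)⁻¹ = δ(Π(1,1))`, so (3) at `a = b = 1` only involves a conjugation and cancels. -/
theorem t_one : t 1 = P (1, 1) := by
  have h1 := h.lax3 1 1
  have h2 := h.lax2 1 1
  have h3 : (s 1)⁻¹ = A'.δ (P (1, 1)) := by
    simpa [mul_assoc, inv_eq_iff_mul_eq_one] using h2.symm
  simp only [map_one, mul_one, sec_eq, h3, secAut_δ] at h1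
  exact (inv_mul_eq_one.mp (by simpa [mul_assoc] using h1)).symm

theorem freeS_of (g : G) : h.freeS (FreeGroup.of g) = s g := by
  simp [freeS, FactorSystem.freeCoc_of, freeProj_of]

theorem freeT_genE (e : E) : h.freeT (A.genE e) = t e := by
  simp [freeT, genE, FactorSystem.freeCoc_of]

theorem freeT_genG (g k : G) : h.freeT (A.genG g k) = P (g, k) := by
  simp only [freeT, genG, FactorSystem.freeCoc_relator, h.t_one]
  simp [factorSystem]

/-- The `c`-terms contributed by `s` and `t` match the formulas for `c(uv)` and `c(uvu⁻¹)`; what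
remains is (2), (3) and (4). -/
theorem isQuadraticDerivation_free :
    IsQuadraticDerivation (f.comp A.proj) h.freeS h.freeT := by
  have hd : IsDerivation A' (f.comp A.proj).φ h.freeS := by
    intro u v
    have h1 : (f.comp A.proj).φ v = f.φ (freeProj G v) := rfl
    rw [h1, freeS, freeS, freeS, FactorSystem.freeCoc_mul, map_mul (freeProj G), h.lax2]
    simp only [map_mul, factorSystem_aut, factorSystem_coc, δ_secAut, A'.δ_act, map_inv (A'.actE _)]
    group
  refine ⟨hd, fun x y => ?_, fun u x => ?_⟩
  · have hx := (A.mem_pullback _).1 x.2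
    have hy := (A.mem_pullback _).1 y.2
    have h3 := h.lax3 x.1.1 y.1.1
    have h1 : (f.comp A.proj).ψ y = f.ψ y.1.1 := rfl
    have h2 : (f.comp A.proj).φ (A.resolution.bd y)⁻¹ = (A'.bd (f.ψ y.1.1))⁻¹ := by
      rw [map_inv, f.bd_comm, hy]
      rfl
    have h4 : h.freeT (x * y) = h.factorSystem.freeCoc (x.1.2 * y.1.2) * t (x.1.1 * y.1.1) := rfl
    have h5 : A.resolution.bd x = x.1.2 := rfl
    have h6 : A.resolution.bd y = y.1.2 := rfl
    rw [h1, h2, h4, sec_eq, secAut_mul_inv_lift, h5, h6, freeS, freeS, freeT, freeT,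
      lift_inv_mul_δ_inv, FactorSystem.freeCoc_mul, factorSystem_aut, factorSystem_coc, ← hx, ← hy,
      mul_assoc, h3, f.bd_comm]
    simp [sec_eq, secAut_δ, mul_assoc]
  · have hx := (A.mem_pullback _).1 x.2
    have h4 := h.lax4 (freeProj G u) x.1.1
    have h1 : (f.comp A.proj).ψ x = f.ψ x.1.1 := rfl
    have h2 : (f.comp A.proj).φ u = f.φ (freeProj G u) := rfl
    have h3 : A.resolution.bd x = x.1.2 := rfl
    have h5 : h.freeT (A.resolution.actE u x) = h.factorSystem.freeCoc (u * x.1.2 * u⁻¹) *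
      t (A.actE (freeProj G u) x.1.1) := rfl
    rw [h1, h2, h3, h5, freeS, freeS, freeT, FactorSystem.freeCoc_conj]
    have h6 := A'.act_twist (f.ψ x.1.1) (s (freeProj G u)) (s (freeProj G x.1.2))
      (h.factorSystem.freeCoc u) (h.factorSystem.freeCoc x.1.2) (t x.1.1)
    simp only [map_mul A'.actL, MulAut.mul_apply, ← map_mul (A'.actL (f.φ (freeProj G u))),
      sec_eq] at h4 ⊢
    rw [h6, map_mul (A'.actL _), ← hx, h4, factorSystem_aut_symm, factorSystem_aut, f.bd_comm]
    simp only [factorSystem_coc, mul_assoc]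

end IsLaxTriple

/-! ### The lax homotopy and the morphism of a triple -/

namespace IsLaxTriple

variable {L E G : Type*} [Group L] [Group E] [Group G]
variable {L' E' G' : Type*} [Group L'] [Group E'] [Group G']
variable {A : TwoCrossedModule L E G} {A' : TwoCrossedModule L' E' G'}
variable {f : Hom A A'} {s : G → E'} {t : E → L'} {P : G × G → L'} (h : IsLaxTriple f s t P)
include h

theorem bd_freeS (u : FreeGroup G) : A'.bd (h.freeS u) = A'.bd (s (freeProj G u)) := by
  simp [freeS]

/-- The factors `c(u)` cancel, so the target morphism on the pullback depends on the `E`-coordinate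
alone. -/
theorem freeS_mul_δ_freeT (x : A.pullback) :
    h.freeS x.1.2 * A'.δ (h.freeT x) = s (A.bd x.1.1) * A'.δ (t x.1.1) := by
  rw [(A.mem_pullback _).1 x.2, freeS, freeT]
  simp [mul_assoc]

theorem freeT_δ (l : L) : h.freeT (A.pullbackδ l) = (P (1, 1))⁻¹ * t (A.δ l) := by
  simp [freeT, FactorSystem.freeCoc_one, factorSystem_coc]

theorem isLaxHomotopy_free {f₂ : Hom A A'} (h₂ : IsLaxTarget f f₂ s t P) :
    IsLaxHomotopy f f₂ h.freeS h.freeT where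
  quadratic := h.isQuadraticDerivation_free
  μ_eq l := by
    change f₂.μ l = f.μ l * h.freeT (A.pullbackδ l)
    rw [h₂.μ_eq, freeT_δ, mul_assoc]
  ψ_eq x := by
    change f₂.ψ x.1.1 = f.ψ x.1.1 * h.freeS x.1.2 * A'.δ (h.freeT x)
    rw [h₂.ψ_eq, mul_assoc, mul_assoc, freeS_mul_δ_freeT]
  φ_eq u := by
    change f₂.φ (freeProj G u) = f.φ (freeProj G u) * A'.bd (h.freeS u)
    rw [h₂.φ_eq, bd_freeS]

theorem restrict_free : A.restrict (h.freeS, h.freeT) = (s, t, P) :=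
  Prod.ext (funext h.freeS_of) (Prod.ext (funext h.freeT_genE)
    (funext fun x => h.freeT_genG x.1 x.2))

/-- The morphism determined by a lax triple. -/
def target : Hom A A' :=
  let F : Hom A.resolution A' := h.isQuadraticDerivation_free.target
  have hψ (x : A.pullback) : F.ψ x = f.ψ x.1.1 * (s (A.bd x.1.1) * A'.δ (t x.1.1)) := by
    rw [← freeS_mul_δ_freeT, ← mul_assoc]
    rfl
  have hφ (u : FreeGroup G) : F.φ u = f.φ (freeProj G u) * A'.bd (s (freeProj G u)) := by
    rw [← h.bd_freeS]
    rfl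
  have hψE (x : A.pullback) : F.ψ x = F.ψ (A.genE x.1.1) := by rw [hψ, hψ]; rfl
  have hφG (u : FreeGroup G) : F.φ u = F.φ (FreeGroup.of (freeProj G u)) := by
    rw [hφ, hφ, freeProj_of]
  -- `e ↦ genE e` and `g ↦ [g]` are only set sections, but `F` is constant on the fibres of `proj`,
  -- so the composites are multiplicative.
  { μ := F.μ
    ψ := MonoidHom.mk' (fun e => F.ψ (A.genE e)) fun a b => by
      rw [← map_mul, hψE (_ * _)]
      rfl
    φ := MonoidHom.mk' (fun g => F.φ (FreeGroup.of g)) fun g k => by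
      rw [← map_mul, hφG (_ * _), map_mul (freeProj G), freeProj_of, freeProj_of]
    δ_comm := fun l => by
      rw [F.δ_comm, hψE]
      rfl
    bd_comm := fun e => F.bd_comm (A.genE e)
    map_lift := fun a b => F.map_lift (A.genE a) (A.genE b)
    map_actL := fun g l => by
      have h1 := F.map_actL (FreeGroup.of g) l
      change F.μ (A.actL (freeProj G (FreeGroup.of g)) l) = _ at h1
      rwa [freeProj_of] at h1
    map_actE := fun g e => by
      have h1 := F.map_actE (FreeGroup.of g) (A.genE e)
      rw [hψE] at h1
      change F.ψ (A.genE (A.actE (freeProj G (FreeGroup.of g)) e)) = _ at h1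
      rwa [freeProj_of] at h1 }

theorem isLaxTarget_target : IsLaxTarget f h.target s t P where
  φ_eq g := by
    change f.φ (freeProj G (FreeGroup.of g)) * A'.bd (h.freeS (FreeGroup.of g)) = _
    rw [freeS_of, freeProj_of]
  ψ_eq e := by
    change f.ψ e * h.freeS (FreeGroup.of (A.bd e)) * A'.δ (h.freeT (A.genE e)) = _
    rw [freeS_of, freeT_genE]
  μ_eq l := by
    change f.μ l * h.freeT (A.pullbackδ l) = _
    rw [freeT_δ, mul_assoc]

end IsLaxTriple

theorem IsLaxTarget.unique {L E G : Type*} [Group L] [Group E] [Group G]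
    {L' E' G' : Type*} [Group L'] [Group E'] [Group G']
    {A : TwoCrossedModule L E G} {A' : TwoCrossedModule L' E' G'} {f f₂ f₃ : Hom A A'}
    {s : G → E'} {t : E → L'} {P : G × G → L'}
    (h₂ : IsLaxTarget f f₂ s t P) (h₃ : IsLaxTarget f f₃ s t P) : f₂ = f₃ := by
  have h1 : f₂.μ = f₃.μ := MonoidHom.ext fun l => by rw [h₂.μ_eq, h₃.μ_eq]
  have h2 : f₂.ψ = f₃.ψ := MonoidHom.ext fun e => by rw [h₂.ψ_eq, h₃.ψ_eq]
  have h3 : f₂.φ = f₃.φ := MonoidHom.ext fun g => by rw [h₂.φ_eq, h₃.φ_eq]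
  cases f₂
  cases f₃
  simp only at h1 h2 h3
  subst h1 h2 h3
  rfl

end TwoCrossedModule

theorem mainTheorem7 {L E G : Type*} [Group L] [Group E] [Group G]
    {L' E' G' : Type*} [Group L'] [Group E'] [Group G']
    (A : TwoCrossedModule L E G) (A' : TwoCrossedModule L' E' G')
    (f₁ : TwoCrossedModule.Hom A A') :
    -- lax homotopies from `f₁` to `f₂` correspond to the triples that satisfy the equations
    (∀ f₂ : TwoCrossedModule.Hom A A',
      Set.BijOn A.restrict
        {st : (FreeGroup G → E') × (A.pullback → L') |
          TwoCrossedModule.IsLaxHomotopy f₁ f₂ st.1 st.2}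
        {x : (G → E') × (E → L') × (G × G → L') |
          TwoCrossedModule.IsLaxTriple f₁ x.1 x.2.1 x.2.2 ∧
          TwoCrossedModule.IsLaxTarget f₁ f₂ x.1 x.2.1 x.2.2}) ∧
    -- every triple that satisfies the equations determines a morphism `f₂` by the formulas
    (∀ (s : G → E') (t : E → L') (P : G × G → L'),
      TwoCrossedModule.IsLaxTriple f₁ s t P →
        ∃! f₂ : TwoCrossedModule.Hom A A', TwoCrossedModule.IsLaxTarget f₁ f₂ s t P) ∧
    -- every set map on `G` extends uniquely to a derivation on the free group
    (∀ s : G → E', ∃! s' : FreeGroup G → E',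
      A'.IsDerivation (f₁.φ.comp (TwoCrossedModule.freeProj G)) s' ∧
        ∀ g, s' (FreeGroup.of g) = s g) ∧
    -- the elements on which `t` is prescribed generate the pullback as a group
    Subgroup.closure (Set.range A.genE ∪ Set.range fun x : G × G => A.genG x.1 x.2) = ⊤ := by
  refine ⟨fun f₂ => ⟨?_, TwoCrossedModule.injOn_restrict f₁ f₂, ?_⟩, fun s t P h => ?_,
    fun s => ?_, A.closure_generators⟩
  · rintro ⟨s, t⟩ h
    exact ⟨h.isLaxTriple, h.isLaxTarget⟩
  · rintro ⟨s, t, P⟩ ⟨h, h₂⟩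
    exact ⟨(h.freeS, h.freeT), h.isLaxHomotopy_free h₂, h.restrict_free⟩
  · exact ⟨h.target, h.isLaxTarget_target, fun f₂ h₂ => h₂.unique h.isLaxTarget_target⟩
  · obtain ⟨s', hs', hof⟩ :=
      A'.exists_isDerivation (f₁.φ.comp (TwoCrossedModule.freeProj G)) s
    exact ⟨s', ⟨hs', hof⟩, fun r hr => hr.1.ext_of hs' fun g => by rw [hr.2, hof]⟩
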